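/- Let $(M,g)$ be an oriented, connected, smooth Riemannian $3$-manifold with (possibly empty) boundary and of constant sectional curvature $c\in\mathbb{R}$. For a smooth vector field $Y$ on $M$ let $Y^\flat=g(Y,\cdot)$, and let $\mathrm{curl}\,Y$ be the vector field with $(\mathrm{curl}\,Y)^\flat=\star\, d(Y^\flat)$, where $\star$ is the Hodge star operator; call $Y$ a Killing field if it satisfies the Killing equations $g(\nabla_X Y,Z)+g(X,\nabla_Z Y)=0$ for all tangent vectors $X,Z$ at a common point, where $\nabla$ is the Levi-Civita connection. If $Y$ is a smooth Killing field on $M$ which is not identically zero and $\mathrm{curl}\,Y=\lambda Y$ for some constant $\lambda\in\mathbb{R}$ ($\lambda=0$ is allowed), then $$c=\frac{\lambda^2}{4}.$$ In particular, if $c<0$, then the only smooth Killing field $Y$ on $M$ which satisfies $\mathrm{curl}\,Y=\lambda Y$ for some constant $\lambda\in\mathbb{R}$ is the zero vector field. The metric $g$ is not required to be complete. -/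

import Mathlib

open Bundle FiberBundle VectorField
open scoped Manifold ContDiff Topology

noncomputable section

namespace RiemGeom

section LeviCivita

variable {E : Type*} [NormedAddCommGroup E] [NormedSpace ℝ E]
  {H : Type*} [TopologicalSpace H] {I : ModelWithCorners ℝ E H}
  {M : Type*} [TopologicalSpace M] [ChartedSpace H M]
  [RiemannianBundle (fun x : M ↦ TangentSpace I x)]

/-- The function `g(X, Y)` for two vector fields `X`, `Y`. -/
def metric (X Y : Π x : M, TangentSpace I x) (x : M) : ℝ := inner ℝ (X x) (Y x)

/-- The Koszul expression
`X g(Y, Z) + Y g(Z, X) - Z g(X, Y) + g([X, Y], Z) - g([Y, Z], X) + g([Z, X], Y)`,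
whose value is `2 g(∇_X Y, Z)` for the Levi-Civita connection `∇`. -/
def koszul (X Y Z : Π x : M, TangentSpace I x) (x : M) : ℝ :=
  d% (metric Y Z) x (X x) + d% (metric Z X) x (Y x) - d% (metric X Y) x (Z x)
    + inner ℝ (mlieBracket I X Y x) (Z x) - inner ℝ (mlieBracket I Y Z x) (X x)
    + inner ℝ (mlieBracket I Z X x) (Y x)

variable {X Y Z W : Π x : M, TangentSpace I x} {x : M} {f : M → ℝ}

lemma metric_comm : metric X Y = metric Y X := by
  ext x; exact real_inner_comm _ _

lemma metric_add_left : metric (X + W) Y = metric X Y + metric W Y := by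
  ext x; exact inner_add_left _ _ _

lemma metric_smul_left : metric (f • X) Y = f * metric X Y := by
  ext x; exact real_inner_smul_left _ _ _

lemma koszul_add_swap :
    koszul X Y Z x + koszul X Z Y x = 2 * d% (metric Y Z) x (X x) := by
  simp only [koszul, metric_comm (X := Y) (Y := X), metric_comm (X := Z) (Y := X),
    metric_comm (X := Z) (Y := Y), mlieBracket_swap_apply (V := Y) (W := X),
    mlieBracket_swap_apply (V := Z) (W := X), mlieBracket_swap_apply (V := Z) (W := Y),
    inner_neg_left]
  ring

lemma koszul_sub_swap :
    koszul X Y Z x - koszul Y X Z x = 2 * inner ℝ (mlieBracket I X Y x) (Z x) := by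
  simp only [koszul, metric_comm (X := Y) (Y := X), metric_comm (X := Z) (Y := X),
    metric_comm (X := Z) (Y := Y), mlieBracket_swap_apply (V := Y) (W := X),
    mlieBracket_swap_apply (V := Z) (W := X), mlieBracket_swap_apply (V := Z) (W := Y),
    inner_neg_left]
  ring

set_option linter.unusedSectionVars false

variable [IsManifold I ∞ M] [FiniteDimensional ℝ E]
  [IsContMDiffRiemannianBundle I ∞ E (fun x : M ↦ TangentSpace I x)]

lemma mdifferentiableAt_metric (hX : MDiffAt (T% X) x) (hY : MDiffAt (T% Y) x) :
    MDiffAt (metric X Y) x :=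
  MDifferentiableAt.inner_bundle (IB := I) (F := E) (E := fun x : M ↦ TangentSpace I x)
    (b := fun x ↦ x) hX hY

lemma koszul_add_left (hX : MDiffAt (T% X) x) (hW : MDiffAt (T% W) x) (hY : MDiffAt (T% Y) x)
    (hZ : MDiffAt (T% Z) x) : koszul (X + W) Y Z x = koszul X Y Z x + koszul W Y Z x := by
  simp only [koszul, metric_comm (X := Z) (Y := X + W), metric_add_left,
    mvfderiv_add (mdifferentiableAt_metric hX hY) (mdifferentiableAt_metric hW hY),
    mvfderiv_add (mdifferentiableAt_metric hX hZ) (mdifferentiableAt_metric hW hZ),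
    mlieBracket_add_left hX hW, mlieBracket_add_right hX hW, Pi.add_apply, map_add,
    inner_add_left, inner_add_right, add_apply, metric_comm (X := Z) (Y := X),
    metric_comm (X := Z) (Y := W)]
  ring

lemma mvfderiv_metric_smul_left (hf : MDiffAt f x) (hX : MDiffAt (T% X) x)
    (hY : MDiffAt (T% Y) x) (v : TangentSpace I x) :
    d% (metric (f • X) Y) x v = f x * d% (metric X Y) x v + metric X Y x * d% f x v := by
  rw [metric_smul_left, mvfderiv_mul hf (mdifferentiableAt_metric hX hY)]
  simp [smul_eq_mul]

lemma koszul_smul_left (hf : MDiffAt f x) (hX : MDiffAt (T% X) x) (hY : MDiffAt (T% Y) x)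
    (hZ : MDiffAt (T% Z) x) : koszul (f • X) Y Z x = f x * koszul X Y Z x := by
  simp only [koszul, metric_comm (X := Z) (Y := f • X), mvfderiv_metric_smul_left hf hX hY,
    mvfderiv_metric_smul_left hf hX hZ, mlieBracket_smul_left hf hX, mlieBracket_smul_right hf hX,
    Pi.smul_apply', map_smul, inner_add_left, inner_smul_left, inner_smul_right]
  simp [metric, metric_comm (X := Z) (Y := X), real_inner_comm]
  ring

lemma koszul_add_middle (hX : MDiffAt (T% X) x) (hY : MDiffAt (T% Y) x) (hW : MDiffAt (T% W) x)
    (hZ : MDiffAt (T% Z) x) : koszul X (Y + W) Z x = koszul X Y Z x + koszul X W Z x := by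
  have h1 := koszul_sub_swap (X := X) (Y := Y + W) (Z := Z) (x := x)
  have h2 := koszul_sub_swap (X := X) (Y := Y) (Z := Z) (x := x)
  have h3 := koszul_sub_swap (X := X) (Y := W) (Z := Z) (x := x)
  rw [koszul_add_left hY hW hX hZ, mlieBracket_add_right hY hW, inner_add_left] at h1
  linarith

lemma koszul_smul_middle (hf : MDiffAt f x) (hX : MDiffAt (T% X) x) (hY : MDiffAt (T% Y) x)
    (hZ : MDiffAt (T% Z) x) :
    koszul X (f • Y) Z x = f x * koszul X Y Z x + 2 * (d% f x (X x) * metric Y Z x) := by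
  have h1 := koszul_sub_swap (X := X) (Y := f • Y) (Z := Z) (x := x)
  have h2 := koszul_sub_swap (X := X) (Y := Y) (Z := Z) (x := x)
  rw [koszul_smul_left hf hY hX hZ, mlieBracket_smul_right hf hY, inner_add_left,
    real_inner_smul_left, real_inner_smul_left] at h1
  simp only [metric]
  linear_combination h1 - f x * h2

lemma koszul_add_right (hX : MDiffAt (T% X) x) (hY : MDiffAt (T% Y) x) (hZ : MDiffAt (T% Z) x)
    (hW : MDiffAt (T% W) x) : koszul X Y (Z + W) x = koszul X Y Z x + koszul X Y W x := by
  have h1 := koszul_add_swap (X := X) (Y := Y) (Z := Z + W) (x := x)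
  have h2 := koszul_add_swap (X := X) (Y := Y) (Z := Z) (x := x)
  have h3 := koszul_add_swap (X := X) (Y := Y) (Z := W) (x := x)
  rw [koszul_add_middle hX hZ hW hY, metric_comm, metric_add_left,
    mvfderiv_add (mdifferentiableAt_metric hZ hY) (mdifferentiableAt_metric hW hY), add_apply,
    metric_comm (X := Z), metric_comm (X := W)] at h1
  linarith

lemma koszul_smul_right (hf : MDiffAt f x) (hX : MDiffAt (T% X) x) (hY : MDiffAt (T% Y) x)
    (hZ : MDiffAt (T% Z) x) : koszul X Y (f • Z) x = f x * koszul X Y Z x := by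
  have h1 := koszul_add_swap (X := X) (Y := Y) (Z := f • Z) (x := x)
  have h2 := koszul_add_swap (X := X) (Y := Y) (Z := Z) (x := x)
  rw [koszul_smul_middle hf hX hZ hY, metric_comm (X := Y) (Y := f • Z),
    mvfderiv_metric_smul_left hf hZ hY, metric_comm (X := Z)] at h1
  linear_combination h1 - f x * h2

open scoped Classical in
/-- The Koszul expression `(X, Z) ↦ 2 g(∇_X Y, Z)` as a bilinear form on `T_x M`, for a vector
field `Y` which is differentiable at `x` (and zero otherwise). -/
def koszulForm (Y : Π x : M, TangentSpace I x) (x : M) :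
    TangentSpace I x →L[ℝ] TangentSpace I x →L[ℝ] ℝ :=
  if hY : MDiffAt (T% Y) x then
    TensorialAt.mkHom₂ (I := I) (F := E) (F' := E) (fun X Z ↦ koszul X Y Z x) x
      (fun _ hZ ↦ ⟨fun hf hX ↦ koszul_smul_left hf hX hY hZ,
        fun hX hW ↦ koszul_add_left hX hW hY hZ⟩)
      (fun _ hX ↦ ⟨fun hf hZ ↦ koszul_smul_right hf hX hY hZ,
        fun hZ hW ↦ koszul_add_right hX hY hZ hW⟩)
  else 0

lemma koszulForm_apply (hX : MDiffAt (T% X) x) (hY : MDiffAt (T% Y) x) (hZ : MDiffAt (T% Z) x) :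
    koszulForm Y x (X x) (Z x) = koszul X Y Z x := by
  rw [koszulForm, dif_pos hY]
  exact TensorialAt.mkHom₂_apply _ _ hX hZ

variable (I) in
lemma finiteDimensional_tangentSpace (x : M) : FiniteDimensional ℝ (TangentSpace I x) :=
  VectorBundle.finiteDimensional ℝ E (fun x : M ↦ TangentSpace I x) x

/-- The vector `α♯` in `T_x M` which corresponds to the covector `α` through the metric:
`g(α♯, v) = α v`. -/
def sharp {x : M} (α : TangentSpace I x →L[ℝ] ℝ) : TangentSpace I x :=
  haveI := finiteDimensional_tangentSpace I x
  haveI : CompleteSpace (TangentSpace I x) := FiniteDimensional.complete ℝ _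
  (InnerProductSpace.toDual ℝ (TangentSpace I x)).symm α

lemma inner_sharp {x : M} (α : TangentSpace I x →L[ℝ] ℝ) (v : TangentSpace I x) :
    inner ℝ (sharp α) v = α v := by
  have := finiteDimensional_tangentSpace I x
  have : CompleteSpace (TangentSpace I x) := FiniteDimensional.complete ℝ _
  exact InnerProductSpace.toDual_symm_apply

lemma eq_of_inner_eq {u v : TangentSpace I x}
    (h : ∀ w : TangentSpace I x, inner ℝ u w = inner ℝ v w) : u = v :=
  ext_inner_right ℝ h

variable (I M) in
/-- The Levi-Civita connection of the Riemannian manifold `M`, through the Koszul formula;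
`leviCivita I M Y x u` is `∇_u Y` for `u` in `T_x M`. -/
def leviCivita : CovariantDerivative I E (fun x : M ↦ TangentSpace I x) where
  toFun Y x :=
    haveI := finiteDimensional_tangentSpace I x
    LinearMap.toContinuousLinearMap
      { toFun u := sharp ((1 / 2 : ℝ) • koszulForm Y x u)
        map_add' u v := eq_of_inner_eq fun w ↦ by
          simp [inner_sharp, inner_add_left]
        map_smul' c u := eq_of_inner_eq fun w ↦ by
          simp [inner_sharp, inner_smul_left]; ring }
  isCovariantDerivativeOnUniv := by
    constructor
    · intro Y W x hY hW _
      ext u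
      refine eq_of_inner_eq fun w ↦ ?_
      have hu := mdifferentiableAt_extend I E u
      have hw := mdifferentiableAt_extend I E w
      have h1 := koszulForm_apply hu hY hw
      have h2 := koszulForm_apply hu hW hw
      have h3 := koszulForm_apply hu (mdifferentiableAt_add_section hY hW) hw
      rw [koszul_add_middle hu hY hW hw] at h3
      simp only [extend_apply_self] at h1 h2 h3
      simp [inner_add_left, inner_sharp, h1, h2, h3, mul_add]
    · intro Y f x hY hf _
      ext u
      refine eq_of_inner_eq fun w ↦ ?_
      have hu := mdifferentiableAt_extend I E u
      have hw := mdifferentiableAt_extend I E w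
      have h1 := koszulForm_apply hu hY hw
      have h3 := koszulForm_apply hu (hf.smul_section hY) hw
      rw [koszul_smul_middle hf hu hY hw] at h3
      simp only [extend_apply_self, metric] at h1 h3
      simp [inner_add_left, inner_smul_left, inner_sharp, h1, h3]
      ring

lemma inner_leviCivita (hX : MDiffAt (T% X) x) (hY : MDiffAt (T% Y) x) (hZ : MDiffAt (T% Z) x) :
    inner ℝ (leviCivita I M Y x (X x)) (Z x) = 1 / 2 * koszul X Y Z x := by
  rw [← koszulForm_apply hX hY hZ]
  exact inner_sharp _ _

/-- The Levi-Civita connection is compatible with the metric. -/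
lemma leviCivita_metric (hX : MDiffAt (T% X) x) (hY : MDiffAt (T% Y) x)
    (hZ : MDiffAt (T% Z) x) :
    d% (metric Y Z) x (X x) =
      inner ℝ (leviCivita I M Y x (X x)) (Z x) + inner ℝ (Y x) (leviCivita I M Z x (X x)) := by
  rw [real_inner_comm (leviCivita I M Z x (X x)), inner_leviCivita hX hY hZ,
    inner_leviCivita hX hZ hY]
  linarith [koszul_add_swap (X := X) (Y := Y) (Z := Z) (x := x)]

/-- The Levi-Civita connection is free of torsion. -/
lemma leviCivita_torsion : (leviCivita I M).torsion = 0 := by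
  rw [CovariantDerivative.torsion_eq_zero_iff]
  intro X Y x hX hY
  refine eq_of_inner_eq fun w ↦ ?_
  have hw := mdifferentiableAt_extend I E w
  have h1 := inner_leviCivita hX hY hw
  have h2 := inner_leviCivita hY hX hw
  have h3 := koszul_sub_swap (X := X) (Y := Y) (Z := extend E w) (x := x)
  simp only [extend_apply_self] at h1 h2 h3
  rw [inner_sub_left, h1, h2]
  linarith

end LeviCivita

section Curvature

variable {E : Type*} [NormedAddCommGroup E] [NormedSpace ℝ E] [FiniteDimensional ℝ E]
  {H : Type*} [TopologicalSpace H] (I : ModelWithCorners ℝ E H)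
  (M : Type*) [TopologicalSpace M] [ChartedSpace H M] [IsManifold I ∞ M]
  [RiemannianBundle (fun x : M ↦ TangentSpace I x)]
  [IsContMDiffRiemannianBundle I ∞ E (fun x : M ↦ TangentSpace I x)]

/-- The vector field `R(X, Y)Z = ∇_X ∇_Y Z - ∇_Y ∇_X Z - ∇_[X, Y] Z`. -/
def curvature (X Y Z : Π x : M, TangentSpace I x) (x : M) : TangentSpace I x :=
  leviCivita I M (fun y ↦ leviCivita I M Z y (Y y)) x (X x)
    - leviCivita I M (fun y ↦ leviCivita I M Z y (X y)) x (Y x)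
    - leviCivita I M Z x (mlieBracket I X Y x)

variable {M}

/-- The vector `R(u, v)w` for `u`, `v`, `w` in `T_x M`: the curvature is tensorial, and is evaluated
on extensions of the three vectors which are smooth near `x`. -/
def curvatureAt {x : M} (u v w : TangentSpace I x) : TangentSpace I x :=
  curvature I M (extend E u) (extend E v) (extend E w) x

/-- The sectional curvature `g(R(u, v)v, u) / (|u|² |v|² - g(u, v)²)` of the plane spanned by two
linearly independent tangent vectors `u`, `v`. -/
def sectionalCurvature {x : M} (u v : TangentSpace I x) : ℝ :=
  inner ℝ (curvatureAt I u v v) u /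
    (inner ℝ u u * inner ℝ v v - inner ℝ u v * inner ℝ u v)

variable (M)

/-- All the tangent planes of `M` have the sectional curvature `c`. -/
def HasConstantSectionalCurvature (c : ℝ) : Prop :=
  ∀ (x : M) (u v : TangentSpace I x), LinearIndependent ℝ ![u, v] → sectionalCurvature I u v = c

variable {M}

/-- The Killing equations `g(∇_u Y, v) + g(u, ∇_v Y) = 0`. -/
def IsKilling (Y : Π x : M, TangentSpace I x) : Prop :=
  ∀ (x : M) (u v : TangentSpace I x),
    inner ℝ (leviCivita I M Y x u) v + inner ℝ u (leviCivita I M Y x v) = 0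

end Curvature

section Curl

variable {E : Type*} [NormedAddCommGroup E] [NormedSpace ℝ E] [FiniteDimensional ℝ E]
  {H : Type*} [TopologicalSpace H] (I : ModelWithCorners ℝ E H)
  (M : Type*) [TopologicalSpace M] [ChartedSpace H M] [IsManifold I ∞ M]

/-- An orientation of the `3`-manifold `M`: a choice of an orientation of each tangent space, such
that each point has a neighbourhood with a continuous positively oriented frame. -/
structure ManifoldOrientation where
  /-- The orientation of the tangent space at `x`. -/
  at_point (x : M) : Orientation ℝ (TangentSpace I x) (Fin 3)
  exists_frame (x : M) : ∃ U ∈ 𝓝 x, ∃ e : Fin 3 → Π y : M, TangentSpace I y,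
    (∀ i, ContinuousOn (fun y ↦ (⟨y, e i y⟩ : TangentBundle I M)) U) ∧
    ∀ y ∈ U, ∃ b : Module.Basis (Fin 3) ℝ (TangentSpace I y),
      (∀ i, b i = e i y) ∧ b.orientation = at_point y

variable {M}

/-- The exterior derivative of a `1`-form, `dα(X, Z) = X (α Z) - Z (α X) - α [X, Z]`, evaluated
on extensions of the two tangent vectors `u`, `v` which are smooth near `x`. -/
def extDerivOneForm (α : Π x : M, TangentSpace I x →L[ℝ] ℝ) (x : M) (u v : TangentSpace I x) : ℝ :=
  d% (fun y ↦ α y (extend E v y)) x u - d% (fun y ↦ α y (extend E u y)) x v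
    - α x (mlieBracket I (extend E u) (extend E v) x)

variable [RiemannianBundle (fun x : M ↦ TangentSpace I x)]
  [IsContMDiffRiemannianBundle I ∞ E (fun x : M ↦ TangentSpace I x)]

/-- The `1`-form `g(X, ·)` which corresponds to the vector field `X` through the metric. -/
def flat (X : Π x : M, TangentSpace I x) (x : M) : TangentSpace I x →L[ℝ] ℝ :=
  innerSL ℝ (X x)

variable [Fact (Module.finrank ℝ E = 3)]

/-- The Hodge star of a `2`-form `β` on `T_x M`: in a positively oriented orthonormal basis
`e₀, e₁, e₂` with the dual basis `e⁰, e¹, e²`, the covector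
`⋆β = β(e₁, e₂) e⁰ + β(e₂, e₀) e¹ + β(e₀, e₁) e²`. -/
def hodgeStar {x : M} (o : Orientation ℝ (TangentSpace I x) (Fin 3))
    (β : TangentSpace I x → TangentSpace I x → ℝ) : TangentSpace I x →L[ℝ] ℝ :=
  let e := o.finOrthonormalBasis (by norm_num) (Fact.out : Module.finrank ℝ E = 3)
  β (e 1) (e 2) • innerSL ℝ (e 0) + β (e 2) (e 0) • innerSL ℝ (e 1)
    + β (e 0) (e 1) • innerSL ℝ (e 2)

/-- The vector field `curl Y`, which is determined by `(curl Y)♭ = ⋆ d(Y♭)`. -/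
def curl (o : ManifoldOrientation I M) (Y : Π x : M, TangentSpace I x) (x : M) :
    TangentSpace I x :=
  sharp (hodgeStar I (o.at_point x) (extDerivOneForm I (flat I Y) x))

end Curl

end RiemGeom

end

/-!
Write `A u = ∇_u Y`. The Killing equations say that `A` is skew, so that `d(Y♭)(u, v) = 2 g(A u, v)`,
and `curl Y = lam Y` becomes `A u = (lam / 2) Y × u` for the cross product of the oriented inner
product space `T_x M`. In an orthonormal basis this gives two facts at each point
(`IsKilling.leviCivita_of_curl_eq_smul`): `A Y = 0`, that is `∇_Y Y = 0`, and
`|A u|² = (lam² / 4) (|u|² |Y|² - g(u, Y)²)`.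

For a Killing field with `∇_Y Y = 0` everywhere,
`R(u, Y)Y = - ∇_Y ∇_U Y - ∇_[U, Y] Y` for any extension `U` of `u`. Since `g(∇_U Y, U) = 0`, pairing
with `u` leaves `g(R(u, Y)Y, u) = |A u|²` (`IsKilling.inner_curvatureAt`). At a point with `Y ≠ 0`,
division by `|u|² |Y|² - g(u, Y)²` shows that the planes containing `Y` have sectional curvature
`lam² / 4`, and this value is `c`.

The remaining work is the passage from the curvature of the smooth extensions of `u`, `Y x`, `Y x`
to the curvature of `U`, `Y`, `Y` (`inner_curvatureAt_eq`). The middle argument of the curvature is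
tensorial (`tensorialAt_curvature`), and the last one is handled by the antisymmetry
`g(R(U, V)Z, T) = - g(Z, R(U, V)T)` (`inner_curvature_swap`), whose right side depends on `Z` only
through `Z x`. Both require that `∇_X Y` is differentiable when `X` and `Y` are regular enough; this
is read off from the Koszul formula, tested against a local orthogonal frame. The antisymmetry also
requires `U V f - V U f = [U, V] f`, which is extracted from the Jacobi identity for
`U`, `V`, `f W` with `W` nonzero at the point.
-/

namespace RiemGeom

/-! ### Derivatives of functions along vector fields -/

section Derivations

variable {E : Type*} [NormedAddCommGroup E] [NormedSpace ℝ E]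
  {H : Type*} [TopologicalSpace H] {I : ModelWithCorners ℝ E H}
  {M : Type*} [TopologicalSpace M] [ChartedSpace H M]
  {X Y U V : Π x : M, TangentSpace I x} {x : M} {f g : M → ℝ}

lemma mvfderiv_congr_of_eventuallyEq (h : f =ᶠ[𝓝 x] g) : d% f x = d% g x := by
  ext u
  exact DFunLike.congr_fun (h.mfderiv_eq (I := I) (I' := 𝓘(ℝ, ℝ))) u

variable [IsManifold I ∞ M]

lemma mdifferentiableAt_of_contMDiffAt_two (hX : CMDiffAt 2 (T% X) x) : MDiffAt (T% X) x :=
  hX.mdifferentiableAt two_ne_zero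

lemma eventually_mdifferentiableAt_vectorField (hX : CMDiffAt 2 (T% X) x) :
    ∀ᶠ y in 𝓝 x, MDiffAt (T% X) y :=
  ((contMDiffAt_iff_contMDiffAt_nhds (by simp)).1 hX).mono fun _ h ↦ h.mdifferentiableAt two_ne_zero

lemma eventually_mdifferentiableAt_function (hf : CMDiffAt 2 f x) :
    ∀ᶠ y in 𝓝 x, MDiffAt f y :=
  ((contMDiffAt_iff_contMDiffAt_nhds (by simp)).1 hf).mono fun _ h ↦ h.mdifferentiableAt two_ne_zero

lemma mdifferentiableAt_mlieBracket [FiniteDimensional ℝ E]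
    (hX : CMDiffAt 2 (T% X) x) (hY : CMDiffAt 2 (T% Y) x) :
    MDiffAt (T% (mlieBracket I X Y)) x := by
  have : IsManifold I ((2 : ℕ∞) + 1) M := IsManifold.of_le (n := ∞) (by norm_cast)
  have : IsManifold I (minSmoothness ℝ 2) M := IsManifold.of_le (n := ∞) (by
    simpa [minSmoothness_of_isRCLikeNormedField] using
      WithTop.coe_le_coe.2 (le_top (a := (2 : ℕ∞))))
  have h := ContMDiffAt.mlieBracket_vectorField (m := 1) (n := 2) hX hY
    (by simp [minSmoothness_of_isRCLikeNormedField]; norm_num)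
  exact h.mdifferentiableAt (by simp)

variable [RiemannianBundle (fun x : M ↦ TangentSpace I x)]
  [IsContMDiffRiemannianBundle I ∞ E (fun x : M ↦ TangentSpace I x)]

lemma contMDiffAt_metric (hX : CMDiffAt 2 (T% X) x) (hY : CMDiffAt 2 (T% Y) x) :
    CMDiffAt 2 (metric X Y) x :=
  ContMDiffAt.inner_bundle (IB := I) (F := E) (E := fun x : M ↦ TangentSpace I x)
    (b := fun x ↦ x) hX hY

variable [FiniteDimensional ℝ E]

/-- The function `X f` is differentiable if `X` and `f` are `C²`: it is the factor of `W` in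
`[X, f W] - f [X, W] = (X f) W`, where `W` is nonzero near `x`. -/
lemma mdifferentiableAt_mvfderiv_apply (hf : CMDiffAt 2 f x) (hX : CMDiffAt 2 (T% X) x) :
    MDiffAt (fun y ↦ d% f y (X y)) x := by
  -- In dimension zero there is no nonzero `W`, but then `X = 0`.
  by_cases hE : ∀ w : TangentSpace I x, w = 0
  · have hE' : ∀ w : E, w = 0 := hE
    have : (fun y ↦ d% f y (X y)) = fun _ ↦ 0 := by
      ext y
      have : X y = 0 := hE' (X y)
      simp [this]
    rw [this]; exact mdifferentiableAt_const
  push Not at hE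
  obtain ⟨w, hw⟩ := hE
  set W : Π x : M, TangentSpace I x := extend E w
  have hW : CMDiffAt 2 (T% W) x := contMDiffAt_extend (k := 2) I E w
  have hWx : metric W W x ≠ 0 := by simpa [metric, W] using hw
  have hfW : CMDiffAt 2 (T% (f • W)) x := hf.smul_section hW
  have hWW := mdifferentiableAt_metric (mdifferentiableAt_of_contMDiffAt_two hW)
    (mdifferentiableAt_of_contMDiffAt_two hW)
  have h1 := mdifferentiableAt_metric (mdifferentiableAt_mlieBracket hX hfW)
    (mdifferentiableAt_of_contMDiffAt_two hW)
  have h2 := mdifferentiableAt_metric (mdifferentiableAt_mlieBracket hX hW)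
    (mdifferentiableAt_of_contMDiffAt_two hW)
  have h3 : MDiffAt ((metric (mlieBracket I X (f • W)) W - f * metric (mlieBracket I X W) W)
      * (metric W W)⁻¹) x :=
    (h1.sub ((hf.mdifferentiableAt two_ne_zero).mul h2)).mul
      (((contMDiffAt_metric hW hW).inv₀ hWx).mdifferentiableAt two_ne_zero)
  refine h3.congr_of_eventuallyEq ?_
  filter_upwards [eventually_mdifferentiableAt_function hf,
    eventually_mdifferentiableAt_vectorField hW, hWW.continuousAt.eventually_ne hWx] with y h1 h2 h3
  simp only [metric] at h3
  simp only [Pi.mul_apply, Pi.sub_apply, Pi.inv_apply, metric]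
  rw [mlieBracket_smul_right h1 h2, inner_add_left, real_inner_smul_left, real_inner_smul_left]
  field_simp
  ring

/-- The Lie bracket is the commutator of derivations, `U V f - V U f = [U, V] f`. The Leibniz rule
turns the Jacobi identity for `U`, `V`, `f W` into that for `U`, `V`, `W` plus this identity
times `W`. -/
lemma mvfderiv_commutator [Nontrivial E] (hf : CMDiffAt 2 f x) (hU : CMDiffAt 2 (T% U) x)
    (hV : CMDiffAt 2 (T% V) x) :
    d% (fun y ↦ d% f y (V y)) x (U x) - d% (fun y ↦ d% f y (U y)) x (V x)
      = d% f x (mlieBracket I U V x) := by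
  obtain ⟨w, hw⟩ : ∃ w : TangentSpace I x, w ≠ 0 := exists_ne (0 : E)
  set W : Π x : M, TangentSpace I x := extend E w
  have hW : CMDiffAt 2 (T% W) x := contMDiffAt_extend (k := 2) I E w
  have hWx : W x ≠ 0 := by simpa [W] using hw
  have hfW : CMDiffAt 2 (T% (f • W)) x := hf.smul_section hW
  have hf1 := hf.mdifferentiableAt two_ne_zero
  have hW1 := mdifferentiableAt_of_contMDiffAt_two hW
  have : IsManifold I (minSmoothness ℝ 3) M := IsManifold.of_le (n := ∞) (by
    simpa [minSmoothness_of_isRCLikeNormedField] using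
      WithTop.coe_le_coe.2 (le_top (a := (3 : ℕ∞))))
  have jac {T : Π x : M, TangentSpace I x} (hT : CMDiffAt 2 (T% T) x) :=
    leibniz_identity_mlieBracket_apply (I := I) (x := x) (U := U) (V := V) (W := T)
    (by simpa [minSmoothness_of_isRCLikeNormedField] using hU)
    (by simpa [minSmoothness_of_isRCLikeNormedField] using hV)
    (by simpa [minSmoothness_of_isRCLikeNormedField] using hT)
  have key {P Q : Π x : M, TangentSpace I x} (hP : CMDiffAt 2 (T% P) x)
      (hQ : CMDiffAt 2 (T% Q) x) : mlieBracket I Q (mlieBracket I P (f • W)) x =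
      d% (fun y ↦ d% f y (P y)) x (Q x) • W x + d% f x (P x) • mlieBracket I Q W x
      + (d% f x (Q x) • mlieBracket I P W x + f x • mlieBracket I Q (mlieBracket I P W) x) := by
    have h : mlieBracket I P (f • W) =ᶠ[𝓝 x]
        (fun y ↦ d% f y (P y)) • W + f • mlieBracket I P W := by
      filter_upwards [eventually_mdifferentiableAt_function hf,
        eventually_mdifferentiableAt_vectorField hW] with y h1 h2
      exact mlieBracket_smul_right h1 h2
    have hPf := mdifferentiableAt_mvfderiv_apply hf hP
    have hPW := mdifferentiableAt_mlieBracket hP hW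
    have h' : mlieBracket I Q (mlieBracket I P (f • W)) x =
        mlieBracket I Q ((fun y ↦ d% f y (P y)) • W + f • mlieBracket I P W) x :=
      Filter.EventuallyEq.mlieBracket_vectorField_eq .rfl h
    rw [h', mlieBracket_add_right (hPf.smul_section hW1) (hf1.smul_section hPW),
      mlieBracket_smul_right hPf hW1, mlieBracket_smul_right hf1 hPW]
  have h1 := jac hfW
  rw [key hV hU, key hU hV, mlieBracket_smul_right hf1 hW1, jac hW] at h1
  have h2 : (d% (fun y ↦ d% f y (V y)) x (U x) - d% (fun y ↦ d% f y (U y)) x (V x)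
      - d% f x (mlieBracket I U V x)) • W x = 0 := by
    refine Eq.trans ?_ (sub_eq_zero.2 h1)
    module
  exact sub_eq_zero.1 ((smul_eq_zero.1 h2).resolve_right hWx)

end Derivations

/-! ### Local orthogonal frames -/

section Frames

open InnerProductSpace

variable {E : Type*} [NormedAddCommGroup E] [NormedSpace ℝ E] [FiniteDimensional ℝ E]
  {H : Type*} [TopologicalSpace H] {I : ModelWithCorners ℝ E H}
  {M : Type*} [TopologicalSpace M] [ChartedSpace H M] [IsManifold I ∞ M]
  [RiemannianBundle (fun x : M ↦ TangentSpace I x)]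
  [IsContMDiffRiemannianBundle I ∞ E (fun x : M ↦ TangentSpace I x)]
  {X S : Π x : M, TangentSpace I x} {x : M}

variable (I) in
/-- The Gram-Schmidt process, applied to the local frame of a trivialization, gives an orthogonal
frame near `x`. Without the normalization no square roots occur, and regularity is preserved. -/
lemma exists_orthogonal_frame (x : M) :
    ∃ e : Fin (Module.finrank ℝ E) → Π y : M, TangentSpace I y,
      (∀ i, CMDiffAt 2 (T% (e i)) x) ∧ (∀ i, metric (e i) (e i) x ≠ 0) ∧
      ∀ᶠ y in 𝓝 x, ∀ v : TangentSpace I y,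
        v = ∑ i, (inner ℝ v (e i y) * (metric (e i) (e i) y)⁻¹) • e i y := by
  let t := trivializationAt E (fun y : M ↦ TangentSpace I y) x
  have hxt : x ∈ t.baseSet := FiberBundle.mem_baseSet_trivializationAt' x
  let b := Module.finBasis ℝ E
  have hfr := t.isLocalFrameOn_localFrame_baseSet I 2 b
  let e : Fin (Module.finrank ℝ E) → Π y : M, TangentSpace I y :=
    fun i y ↦ gramSchmidt ℝ (fun j ↦ t.localFrame b j y) i
  have hne {y : M} (hy : y ∈ t.baseSet) (i) : metric (e i) (e i) y ≠ 0 := by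
    simpa [metric, e] using gramSchmidt_ne_zero i (hfr.linearIndependent hy)
  refine ⟨e, fun i ↦ ?_, hne hxt, ?_⟩
  · induction i using WellFoundedLT.induction with
    | ind i ih =>
      have hfi : CMDiffAt 2 (T% (t.localFrame b i)) x := hfr.contMDiffAt t.open_baseSet hxt i
      have h : CMDiffAt 2 (T% (t.localFrame b i - fun y ↦ ∑ j ∈ Finset.Iio i,
          ((metric (e j) (t.localFrame b i) * (metric (e j) (e j))⁻¹) • e j) y)) x := by
        refine hfi.sub_section (.sum_section fun j hj ↦ ?_)
        have hj := ih j (Finset.mem_Iio.1 hj)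
        exact ((contMDiffAt_metric hj hfi).mul
          ((contMDiffAt_metric hj hj).inv₀ (hne hxt j))).smul_section hj
      convert h using 3 with y
      simp only [e, Pi.sub_apply]
      rw [gramSchmidt_def]
      congr 1
      refine Finset.sum_congr rfl fun j _ ↦ ?_
      simp [Submodule.starProjection_singleton, metric, div_eq_mul_inv]
  · filter_upwards [t.open_baseSet.mem_nhds hxt] with y hy v
    have hli : LinearIndependent ℝ (e · y) := gramSchmidt_linearIndependent (hfr.linearIndependent hy)
    have hsp : ⊤ ≤ Submodule.span ℝ (Set.range (e · y)) := by
      refine (hfr.generating hy).trans (span_gramSchmidt ℝ _).ge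
    obtain ⟨c, rfl⟩ := (Submodule.mem_span_range_iff_exists_fun ℝ).1 (hsp (Submodule.mem_top (x := v)))
    refine Finset.sum_congr rfl fun i _ ↦ ?_
    congr 1
    rw [sum_inner, Finset.sum_eq_single i]
    · have := hne hy i
      simp only [metric] at this ⊢
      rw [real_inner_smul_left]
      field_simp
    · intro j _ hj
      rw [real_inner_smul_left]
      simp [e, gramSchmidt_orthogonal ℝ _ hj]
    · simp

/-- A vector field is differentiable if its products with all `C²` vector fields are. -/
lemma mdifferentiableAt_of_metric
    (hS : ∀ Z : Π x : M, TangentSpace I x, CMDiffAt 2 (T% Z) x → MDiffAt (metric S Z) x) :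
    MDiffAt (T% S) x := by
  obtain ⟨e, he, hne, hsum⟩ := exists_orthogonal_frame I x
  have h : MDiffAt (T% (fun y ↦ ∑ i, ((metric S (e i) * (metric (e i) (e i))⁻¹) • e i) y)) x :=
    .sum_section fun i _ ↦ ((hS _ (he i)).mul
      (((contMDiffAt_metric (he i) (he i)).inv₀ (hne i)).mdifferentiableAt
        two_ne_zero)).smul_section (mdifferentiableAt_of_contMDiffAt_two (he i))
  refine h.congr_of_eventuallyEq ?_
  filter_upwards [hsum] with y hy
  exact congrArg (TotalSpace.mk' E y) (hy (S y))

lemma exists_smul_frame_expansion (hX : MDiffAt (T% X) x) :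
    ∃ (c : Fin (Module.finrank ℝ E) → M → ℝ)
      (e : Fin (Module.finrank ℝ E) → Π y : M, TangentSpace I y),
      (∀ i, MDiffAt (c i) x) ∧ (∀ i, CMDiffAt 2 (T% (e i)) x) ∧
      ∀ᶠ y in 𝓝 x, X y = ∑ i, c i y • e i y := by
  obtain ⟨e, he, hne, hsum⟩ := exists_orthogonal_frame I x
  refine ⟨fun i ↦ metric X (e i) * (metric (e i) (e i))⁻¹, e, fun i ↦ ?_, he, ?_⟩
  · exact (mdifferentiableAt_metric hX (mdifferentiableAt_of_contMDiffAt_two (he i))).mul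
      (((contMDiffAt_metric (he i) (he i)).inv₀ (hne i)).mdifferentiableAt two_ne_zero)
  · filter_upwards [hsum] with y hy
    exact hy (X y)

end Frames

/-! ### Regularity of the Levi-Civita connection and symmetries of the curvature -/

section Curvature

variable {E : Type*} [NormedAddCommGroup E] [NormedSpace ℝ E] [FiniteDimensional ℝ E]
  {H : Type*} [TopologicalSpace H] {I : ModelWithCorners ℝ E H}
  {M : Type*} [TopologicalSpace M] [ChartedSpace H M] [IsManifold I ∞ M]
  [RiemannianBundle (fun x : M ↦ TangentSpace I x)]
  [IsContMDiffRiemannianBundle I ∞ E (fun x : M ↦ TangentSpace I x)]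
  {X Y Z U V D T : Π x : M, TangentSpace I x} {x : M}

/-- Metric compatibility at a single tangent vector. -/
lemma mvfderiv_metric_apply (hY : MDiffAt (T% Y) x) (hZ : MDiffAt (T% Z) x)
    (u : TangentSpace I x) :
    d% (metric Y Z) x u =
      inner ℝ (leviCivita I M Y x u) (Z x) + inner ℝ (Y x) (leviCivita I M Z x u) := by
  simpa using leviCivita_metric (mdifferentiableAt_extend I E u) hY hZ

lemma leviCivita_sub_swap (hX : MDiffAt (T% X) x) (hY : MDiffAt (T% Y) x) :
    leviCivita I M Y x (X x) - leviCivita I M X x (Y x) = mlieBracket I X Y x :=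
  (CovariantDerivative.torsion_eq_zero_iff _).1 leviCivita_torsion hX hY

lemma mdifferentiableAt_leviCivita_of_contMDiffAt (hX : CMDiffAt 2 (T% X) x)
    (hY : CMDiffAt 2 (T% Y) x) :
    MDiffAt (T% (fun y ↦ leviCivita I M Y y (X y))) x := by
  refine mdifferentiableAt_of_metric fun Z hZ ↦ ?_
  have bracket {P Q R : Π x : M, TangentSpace I x} (hP : CMDiffAt 2 (T% P) x)
      (hQ : CMDiffAt 2 (T% Q) x) (hR : CMDiffAt 2 (T% R) x) :
      MDiffAt (fun y ↦ inner ℝ (mlieBracket I P Q y) (R y)) x :=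
    mdifferentiableAt_metric (mdifferentiableAt_mlieBracket hP hQ)
      (mdifferentiableAt_of_contMDiffAt_two hR)
  have deriv {P Q R : Π x : M, TangentSpace I x} (hP : CMDiffAt 2 (T% P) x)
      (hQ : CMDiffAt 2 (T% Q) x) (hR : CMDiffAt 2 (T% R) x) :
      MDiffAt (fun y ↦ d% (metric P Q) y (R y)) x :=
    mdifferentiableAt_mvfderiv_apply (contMDiffAt_metric hP hQ) hR
  have hk : MDiffAt (koszul X Y Z) x :=
    (((((deriv hY hZ hX).add (deriv hZ hX hY)).sub (deriv hX hY hZ)).add (bracket hX hY hZ)).sub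
      (bracket hY hZ hX)).add (bracket hZ hX hY)
  refine ((mdifferentiableAt_const (c := (1 / 2 : ℝ))).mul hk).congr_of_eventuallyEq ?_
  filter_upwards [eventually_mdifferentiableAt_vectorField hX,
    eventually_mdifferentiableAt_vectorField hY,
    eventually_mdifferentiableAt_vectorField hZ] with y h1 h2 h3
  exact inner_leviCivita h1 h2 h3

/-- The vector field `∇_X Y` is differentiable even if `X` is merely differentiable, since it is
linear over functions in `X`; `mdifferentiableAt_leviCivita_of_contMDiffAt` needs a `C²` field because
the Koszul formula differentiates all the fields. -/
lemma mdifferentiableAt_leviCivita (hX : MDiffAt (T% X) x) (hY : CMDiffAt 2 (T% Y) x) :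
    MDiffAt (T% (fun y ↦ leviCivita I M Y y (X y))) x := by
  obtain ⟨c, e, hc, he, hsum⟩ := exists_smul_frame_expansion hX
  have h : MDiffAt (T% (fun y ↦ ∑ i, (c i • fun z ↦ leviCivita I M Y z (e i z)) y)) x :=
    .sum_section fun i _ ↦
      (hc i).smul_section (mdifferentiableAt_leviCivita_of_contMDiffAt (he i) hY)
  refine h.congr_of_eventuallyEq ?_
  filter_upwards [hsum] with y hy
  refine congrArg (TotalSpace.mk' E y) ?_
  rw [hy, map_sum]
  simp

lemma tensorialAt_curvature (hU : CMDiffAt 2 (T% U) x) (hZ : CMDiffAt 2 (T% Z) x) :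
    TensorialAt I E (fun D ↦ curvature I M U D Z x) x where
  smul {f D} hf hD := by
    have hU1 := mdifferentiableAt_of_contMDiffAt_two hU
    have hDZ := mdifferentiableAt_leviCivita hD hZ
    have h : (fun y ↦ leviCivita I M Z y ((f • D) y)) =
        f • fun y ↦ leviCivita I M Z y (D y) := by
      ext y; simp
    simp only [curvature]
    rw [h, (leviCivita I M).isCovariantDerivativeOn.leibniz hDZ hf, mlieBracket_smul_right hf hD]
    simp
    module
  add {D D'} hD hD' := by
    have h : (fun y ↦ leviCivita I M Z y ((D + D') y)) =
        (fun y ↦ leviCivita I M Z y (D y)) + fun y ↦ leviCivita I M Z y (D' y) := by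
      ext y; simp
    simp only [curvature]
    rw [h, (leviCivita I M).isCovariantDerivativeOn.add (mdifferentiableAt_leviCivita hD hZ)
      (mdifferentiableAt_leviCivita hD' hZ), mlieBracket_add_right hD hD']
    simp
    abel

/-- The second derivative `U V g(Z, T)` expanded by metric compatibility. Apart from this second
derivative, the right side is symmetric in `U` and `V`. -/
lemma inner_leviCivita_leviCivita_add (hV : CMDiffAt 2 (T% V) x)
    (hZ : CMDiffAt 2 (T% Z) x) (hT : CMDiffAt 2 (T% T) x) :
    inner ℝ (leviCivita I M (fun y ↦ leviCivita I M Z y (V y)) x (U x)) (T x)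
      + inner ℝ (Z x) (leviCivita I M (fun y ↦ leviCivita I M T y (V y)) x (U x))
      = d% (fun y ↦ d% (metric Z T) y (V y)) x (U x)
        - inner ℝ (leviCivita I M Z x (U x)) (leviCivita I M T x (V x))
        - inner ℝ (leviCivita I M Z x (V x)) (leviCivita I M T x (U x)) := by
  have hV1 := mdifferentiableAt_of_contMDiffAt_two hV
  have hZ1 := mdifferentiableAt_of_contMDiffAt_two hZ
  have hT1 := mdifferentiableAt_of_contMDiffAt_two hT
  have hVZ := mdifferentiableAt_leviCivita hV1 hZ
  have hVT := mdifferentiableAt_leviCivita hV1 hT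
  have h : (fun y ↦ d% (metric Z T) y (V y)) =ᶠ[𝓝 x]
      metric (fun y ↦ leviCivita I M Z y (V y)) T
        + metric Z (fun y ↦ leviCivita I M T y (V y)) := by
    filter_upwards [eventually_mdifferentiableAt_vectorField hZ,
      eventually_mdifferentiableAt_vectorField hT] with y h1 h2
    exact mvfderiv_metric_apply h1 h2 (V y)
  rw [mvfderiv_congr_of_eventuallyEq h,
    mvfderiv_add (mdifferentiableAt_metric hVZ hT1) (mdifferentiableAt_metric hZ1 hVT),
    add_apply, mvfderiv_metric_apply hVZ hT1, mvfderiv_metric_apply hZ1 hVT]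
  ring

lemma inner_curvature_swap [Nontrivial E] (hU : CMDiffAt 2 (T% U) x)
    (hV : CMDiffAt 2 (T% V) x) (hZ : CMDiffAt 2 (T% Z) x) (hT : CMDiffAt 2 (T% T) x) :
    inner ℝ (curvature I M U V Z x) (T x) = -inner ℝ (Z x) (curvature I M U V T x) := by
  have h1 := inner_leviCivita_leviCivita_add (U := U) hV hZ hT
  have h2 := inner_leviCivita_leviCivita_add (U := V) hU hZ hT
  have h3 := mvfderiv_commutator (contMDiffAt_metric hZ hT) hU hV
  have h4 := mvfderiv_metric_apply (mdifferentiableAt_of_contMDiffAt_two hZ)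
    (mdifferentiableAt_of_contMDiffAt_two hT) (mlieBracket I U V x)
  simp only [curvature, inner_sub_left, inner_sub_right]
  linarith

/-- The number `g(R(u, v)v, u)` at `v = Y x` may be computed with `Y` in place of the extension
of `v`. -/
lemma inner_curvatureAt_eq [Nontrivial E] (u : TangentSpace I x) (hY : CMDiffAt 2 (T% Y) x) :
    inner ℝ (curvatureAt I u (Y x) (Y x)) u =
      inner ℝ (curvature I M (extend E u) Y Y x) u := by
  have hU : CMDiffAt 2 (T% (extend E u)) x := contMDiffAt_extend (k := 2) I E u
  have hV : CMDiffAt 2 (T% (extend E (Y x))) x := contMDiffAt_extend (k := 2) I E (Y x)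
  have h1 := inner_curvature_swap hU hV hV hU
  have h2 := inner_curvature_swap hU hV hY hU
  simp only [extend_apply_self] at h1 h2
  -- The antisymmetry replaces the last argument, and tensoriality the middle one.
  rw [curvatureAt, h1, ← h2, (tensorialAt_curvature hU hY).pointwise
    (mdifferentiableAt_of_contMDiffAt_two hV) (mdifferentiableAt_of_contMDiffAt_two hY)
    (extend_apply_self ..)]

end Curvature

/-! ### The curvature along a geodesic Killing field -/

section Killing

variable {E : Type*} [NormedAddCommGroup E] [NormedSpace ℝ E] [FiniteDimensional ℝ E]
  {H : Type*} [TopologicalSpace H] {I : ModelWithCorners ℝ E H}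
  {M : Type*} [TopologicalSpace M] [ChartedSpace H M] [IsManifold I ∞ M]
  [RiemannianBundle (fun x : M ↦ TangentSpace I x)]
  [IsContMDiffRiemannianBundle I ∞ E (fun x : M ↦ TangentSpace I x)]
  {Y : Π x : M, TangentSpace I x} {x : M}

/-- For a Killing field `Y` with `∇_Y Y = 0`, `g(R(u, Y)Y, u) = |∇_u Y|²`. -/
lemma IsKilling.inner_curvatureAt [Nontrivial E] (hK : IsKilling I Y) (hY : CMDiff 2 (T% Y))
    (hgeo : ∀ y, leviCivita I M Y y (Y y) = 0) (u : TangentSpace I x) :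
    inner ℝ (curvatureAt I u (Y x) (Y x)) u =
      inner ℝ (leviCivita I M Y x u) (leviCivita I M Y x u) := by
  set U : Π x : M, TangentSpace I x := extend E u
  have hUx : U x = u := extend_apply_self ..
  have hU : CMDiffAt 2 (T% U) x := contMDiffAt_extend (k := 2) I E u
  have hU1 := mdifferentiableAt_of_contMDiffAt_two hU
  have hY1 := mdifferentiableAt_of_contMDiffAt_two (hY x)
  have hzero : (fun y ↦ leviCivita I M Y y (Y y)) = 0 := funext hgeo
  have hskew : metric (fun y ↦ leviCivita I M Y y (U y)) U = 0 := by
    ext y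
    have := hK y (U y) (U y)
    rw [real_inner_comm (leviCivita I M Y y (U y))] at this
    simp only [metric, Pi.zero_apply]
    linarith
  have h1 := mvfderiv_metric_apply (mdifferentiableAt_leviCivita hU1 (hY x)) hU1 (Y x)
  rw [hskew, mvfderiv_zero, zero_apply, hUx] at h1
  have h2 := hK x (leviCivita I M Y x u) u
  have h3 := hK x (leviCivita I M U x (Y x)) u
  have h4 := leviCivita_sub_swap hU1 hY1
  rw [hUx] at h4
  rw [inner_curvatureAt_eq u (hY x)]
  change inner ℝ (curvature I M U Y Y x) u = _
  rw [curvature, hzero, CovariantDerivative.zero, ← h4, hUx]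
  simp only [Pi.zero_apply, zero_apply, inner_sub_left, inner_zero_left, map_sub]
  rw [real_inner_comm (leviCivita I M U x (Y x))] at h1
  linarith

end Killing

/-! ### The curl in an orthonormal basis -/

section Curl

variable {E : Type*} [NormedAddCommGroup E] [NormedSpace ℝ E] [FiniteDimensional ℝ E]
  {H : Type*} [TopologicalSpace H] {I : ModelWithCorners ℝ E H}
  {M : Type*} [TopologicalSpace M] [ChartedSpace H M] [IsManifold I ∞ M]
  [RiemannianBundle (fun x : M ↦ TangentSpace I x)]
  [IsContMDiffRiemannianBundle I ∞ E (fun x : M ↦ TangentSpace I x)]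
  {Y : Π x : M, TangentSpace I x} {x : M}

/-- The torsion-free formula `d(Y♭)(u, v) = g(∇_u Y, v) - g(∇_v Y, u)`. -/
lemma extDerivOneForm_flat (hY : MDiffAt (T% Y) x) (u v : TangentSpace I x) :
    extDerivOneForm I (flat I Y) x u v =
      inner ℝ (leviCivita I M Y x u) v - inner ℝ (leviCivita I M Y x v) u := by
  have hu := mdifferentiableAt_extend I E u
  have hv := mdifferentiableAt_extend I E v
  have h1 := mvfderiv_metric_apply hY hv u
  have h2 := mvfderiv_metric_apply hY hu v
  have h3 := leviCivita_sub_swap hu hv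
  simp only [extend_apply_self] at h1 h2 h3
  change d% (metric Y (extend E v)) x u - d% (metric Y (extend E u)) x v
    - inner ℝ (Y x) (mlieBracket I (extend E u) (extend E v) x) = _
  rw [h1, h2, ← h3, inner_sub_right]
  ring

lemma IsKilling.extDerivOneForm_flat (hK : IsKilling I Y) (hY : MDiffAt (T% Y) x)
    (u v : TangentSpace I x) :
    extDerivOneForm I (flat I Y) x u v = 2 * inner ℝ (leviCivita I M Y x u) v := by
  have := hK x u v
  rw [real_inner_comm (leviCivita I M Y x v)] at this
  rw [RiemGeom.extDerivOneForm_flat hY]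
  linarith

lemma isKilling_zero : IsKilling I (0 : Π x : M, TangentSpace I x) := by
  intro x u v
  simp

variable [Fact (Module.finrank ℝ E = 3)]

/-- The positively oriented orthonormal basis in which the Hodge star is computed gives the
coefficients of the curl. -/
lemma exists_orthonormalBasis_inner_curl (o : ManifoldOrientation I M)
    (Y : Π x : M, TangentSpace I x) (x : M) :
    ∃ e : OrthonormalBasis (Fin 3) ℝ (TangentSpace I x),
      inner ℝ (curl I o Y x) (e 0) = extDerivOneForm I (flat I Y) x (e 1) (e 2) ∧
      inner ℝ (curl I o Y x) (e 1) = extDerivOneForm I (flat I Y) x (e 2) (e 0) ∧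
      inner ℝ (curl I o Y x) (e 2) = extDerivOneForm I (flat I Y) x (e 0) (e 1) := by
  refine ⟨(o.at_point x).finOrthonormalBasis (by norm_num)
    (Fact.out : Module.finrank ℝ E = 3), ?_, ?_, ?_⟩ <;>
  simp [curl, inner_sharp, hodgeStar]

end Curl

/-- A skew map `A` of an oriented three-dimensional inner product space is `u ↦ (lam / 2) y × u` if
its coefficients are those of `(lam / 2) y`; hence `A y = 0` and
`|A u|² = (lam² / 4) |y × u|²`. -/
lemma skew_apply_of_coeff_eq {V : Type*} [NormedAddCommGroup V] [InnerProductSpace ℝ V]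
    (e : OrthonormalBasis (Fin 3) ℝ V) (A : V →ₗ[ℝ] V) (y : V) (lam : ℝ)
    (hA : ∀ u v, inner ℝ (A u) v + inner ℝ u (A v) = 0)
    (h0 : lam * inner ℝ y (e 0) = 2 * inner ℝ (A (e 1)) (e 2))
    (h1 : lam * inner ℝ y (e 1) = 2 * inner ℝ (A (e 2)) (e 0))
    (h2 : lam * inner ℝ y (e 2) = 2 * inner ℝ (A (e 0)) (e 1)) :
    A y = 0 ∧ ∀ u, inner ℝ (A u) (A u) =
      lam ^ 2 / 4 * (inner ℝ u u * inner ℝ y y - inner ℝ u y * inner ℝ u y) := by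
  have hskew (i j) : inner ℝ (A (e i)) (e j) = -inner ℝ (A (e j)) (e i) := by
    have := hA (e i) (e j)
    rw [real_inner_comm (A (e j))] at this
    linarith
  have hd (i) : inner ℝ (A (e i)) (e i) = 0 := by linarith [hskew i i]
  have hAu (u : V) (j) : inner ℝ (A u) (e j) = inner ℝ u (e 0) * inner ℝ (A (e 0)) (e j)
      + inner ℝ u (e 1) * inner ℝ (A (e 1)) (e j)
      + inner ℝ u (e 2) * inner ℝ (A (e 2)) (e j) := by
    conv_lhs => rw [← e.sum_repr' u]
    simp [Fin.sum_univ_three, inner_add_left, inner_smul_left, real_inner_comm]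
  have hin (u v : V) : inner ℝ u v = inner ℝ u (e 0) * inner ℝ v (e 0)
      + inner ℝ u (e 1) * inner ℝ v (e 1) + inner ℝ u (e 2) * inner ℝ v (e 2) := by
    rw [← e.sum_inner_mul_inner u v]
    simp [Fin.sum_univ_three, real_inner_comm]
  have e12 : inner ℝ (A (e 1)) (e 2) = lam * inner ℝ y (e 0) / 2 := by linarith
  have e20 : inner ℝ (A (e 2)) (e 0) = lam * inner ℝ y (e 1) / 2 := by linarith
  have e01 : inner ℝ (A (e 0)) (e 1) = lam * inner ℝ y (e 2) / 2 := by linarith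
  have c0 (u : V) : inner ℝ (A u) (e 0) =
      lam / 2 * (inner ℝ u (e 2) * inner ℝ y (e 1) - inner ℝ u (e 1) * inner ℝ y (e 2)) := by
    rw [hAu, hd, hskew 1 0, e01, e20]; ring
  have c1 (u : V) : inner ℝ (A u) (e 1) =
      lam / 2 * (inner ℝ u (e 0) * inner ℝ y (e 2) - inner ℝ u (e 2) * inner ℝ y (e 0)) := by
    rw [hAu, hd, hskew 2 1, e01, e12]; ring
  have c2 (u : V) : inner ℝ (A u) (e 2) =
      lam / 2 * (inner ℝ u (e 1) * inner ℝ y (e 0) - inner ℝ u (e 0) * inner ℝ y (e 1)) := by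
    rw [hAu, hd, hskew 0 2, e12, e20]; ring
  refine ⟨?_, fun u ↦ ?_⟩
  · rw [← inner_self_eq_zero (𝕜 := ℝ), hin, c0, c1, c2]
    ring
  · rw [hin (A u), hin u u, hin y y, hin u y, c0, c1, c2]
    ring

/-! ### Killing fields which are eigenfields of the curl -/

section CurlEigenfield

variable {E : Type*} [NormedAddCommGroup E] [NormedSpace ℝ E] [FiniteDimensional ℝ E]
  [Fact (Module.finrank ℝ E = 3)]
  {H : Type*} [TopologicalSpace H] {I : ModelWithCorners ℝ E H}
  {M : Type*} [TopologicalSpace M] [ChartedSpace H M] [IsManifold I ∞ M]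
  [RiemannianBundle (fun x : M ↦ TangentSpace I x)]
  [IsContMDiffRiemannianBundle I ∞ E (fun x : M ↦ TangentSpace I x)]
  {Y : Π x : M, TangentSpace I x} {x : M}

lemma IsKilling.leviCivita_of_curl_eq_smul (o : ManifoldOrientation I M) (hK : IsKilling I Y)
    (hY : MDiffAt (T% Y) x) {lam : ℝ} (hcurl : curl I o Y x = lam • Y x) :
    leviCivita I M Y x (Y x) = 0 ∧ ∀ u : TangentSpace I x,
      inner ℝ (leviCivita I M Y x u) (leviCivita I M Y x u) =
        lam ^ 2 / 4 * (inner ℝ u u * inner ℝ (Y x) (Y x) - inner ℝ u (Y x) * inner ℝ u (Y x)) := by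
  obtain ⟨e, h0, h1, h2⟩ := exists_orthonormalBasis_inner_curl o Y x
  simp only [hcurl, real_inner_smul_left, hK.extDerivOneForm_flat hY] at h0 h1 h2
  exact skew_apply_of_coeff_eq e (leviCivita I M Y x).toLinearMap (Y x) lam (hK x) h0 h1 h2

lemma IsKilling.eq_sq_div_four_of_curl_eq_smul (o : ManifoldOrientation I M) {c : ℝ}
    (hc : HasConstantSectionalCurvature I M c) (hK : IsKilling I Y) (hY : CMDiff 2 (T% Y))
    {lam : ℝ} (hcurl : ∀ y, curl I o Y y = lam • Y y) (hx : Y x ≠ 0) : c = lam ^ 2 / 4 := by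
  have hfin : Module.finrank ℝ E = 3 := Fact.out
  have : Nontrivial E := Module.nontrivial_of_finrank_pos (R := ℝ) (by omega)
  have key (y) := hK.leviCivita_of_curl_eq_smul o
    (mdifferentiableAt_of_contMDiffAt_two (hY y)) (hcurl y)
  -- Any plane through `Y x` will do.
  obtain ⟨u, hu⟩ : ∃ u : TangentSpace I x, LinearIndependent ℝ ![Y x, u] :=
    exists_linearIndependent_pair_of_one_lt_finrank
      (show 1 < Module.finrank ℝ (TangentSpace I x) from hfin ▸ (by norm_num)) hx
  have hu' : LinearIndependent ℝ ![u, Y x] := LinearIndependent.pair_symm_iff.1 hu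
  have hpos : inner ℝ u u * inner ℝ (Y x) (Y x) - inner ℝ u (Y x) * inner ℝ u (Y x) ≠ 0 := by
    have := Matrix.det_gram_ne_zero_iff_linearIndependent.2 hu'
    simpa [Matrix.det_fin_two, Matrix.gram, real_inner_comm] using this
  rw [← hc x u (Y x) hu', sectionalCurvature, hK.inner_curvatureAt hY (fun y ↦ (key y).1),
    (key x).2, mul_div_cancel_right₀ _ hpos]

lemma curl_zero (o : ManifoldOrientation I M) : curl I o (0 : Π x : M, TangentSpace I x) = 0 := by
  ext x
  obtain ⟨e, h0, h1, h2⟩ := exists_orthonormalBasis_inner_curl o (0 : Π x : M, TangentSpace I x) x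
  have hY : MDiffAt (T% (0 : Π x : M, TangentSpace I x)) x := mdifferentiableAt_zeroSection ..
  simp only [isKilling_zero.extDerivOneForm_flat hY, CovariantDerivative.zero, Pi.zero_apply,
    zero_apply, inner_zero_left, mul_zero] at h0 h1 h2
  rw [real_inner_comm] at h0 h1 h2
  rw [← e.sum_repr' (curl I o 0 x)]
  simp [Fin.sum_univ_three, h0, h1, h2]

end CurlEigenfield

end RiemGeom

theorem theorem9
    {E : Type*} [NormedAddCommGroup E] [NormedSpace ℝ E] [FiniteDimensional ℝ E]
    [Fact (Module.finrank ℝ E = 3)]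
    {H : Type*} [TopologicalSpace H] (I : ModelWithCorners ℝ E H)
    {M : Type*} [TopologicalSpace M] [ChartedSpace H M] [IsManifold I ∞ M]
    [T2Space M] [SecondCountableTopology M] [ConnectedSpace M]
    [RiemannianBundle (fun x : M ↦ TangentSpace I x)]
    [IsContMDiffRiemannianBundle I ∞ E (fun x : M ↦ TangentSpace I x)]
    (o : RiemGeom.ManifoldOrientation I M)
    (c : ℝ) (hc : RiemGeom.HasConstantSectionalCurvature I M c) :
    (∀ Y : Π x : M, TangentSpace I x,
      ContMDiff I I.tangent ∞ (fun x ↦ (⟨x, Y x⟩ : TangentBundle I M)) → Y ≠ 0 →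
      RiemGeom.IsKilling I Y → ∀ lam : ℝ, (∀ x, RiemGeom.curl I o Y x = lam • Y x) →
      c = lam ^ 2 / 4) ∧
    (c < 0 → ∀ Y : Π x : M, TangentSpace I x,
      (ContMDiff I I.tangent ∞ (fun x ↦ (⟨x, Y x⟩ : TangentBundle I M)) ∧
        RiemGeom.IsKilling I Y ∧ ∃ lam : ℝ, ∀ x, RiemGeom.curl I o Y x = lam • Y x) ↔
      Y = 0) := by
  have main (Y : Π x : M, TangentSpace I x)
      (hY : ContMDiff I I.tangent ∞ (fun x ↦ (⟨x, Y x⟩ : TangentBundle I M))) (hne : Y ≠ 0)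
      (hK : RiemGeom.IsKilling I Y) (lam : ℝ) (hcurl : ∀ x, RiemGeom.curl I o Y x = lam • Y x) :
      c = lam ^ 2 / 4 := by
    obtain ⟨x, hx⟩ := Function.ne_iff.1 hne
    exact hK.eq_sq_div_four_of_curl_eq_smul o hc
      (hY.of_le (WithTop.coe_le_coe.2 (le_top (a := (2 : ℕ∞))))) hcurl hx
  refine ⟨main, fun hneg Y ↦ ⟨fun ⟨hY, hK, lam, hcurl⟩ ↦ ?_, ?_⟩⟩
  · by_contra hne
    have := main Y hY hne hK lam hcurl
    nlinarith [sq_nonneg lam]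
  · rintro rfl
    exact ⟨contMDiff_zeroSection ℝ (fun x : M ↦ TangentSpace I x), RiemGeom.isKilling_zero, 0,
      fun x ↦ by simp [RiemGeom.curl_zero]⟩
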